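/- **Model.** Time is slotted. In slot $n$ a number $a_n\in\{0,1,2,\dots\}$ of requests arrives; request $i$ has $v_p(i)\ge 1$ prefill tokens, $v_d(i)\ge 1$ decode tokens and a feature $z(i)$ in a finite set. The sequences $(a_n)_n$ and $(v_p(i),v_d(i),z(i))_i$ are each i.i.d. and are independent of each other (the components of a triple may be dependent), with finite means $\lambda=\mathbb E[a_1]$, $m_p=\mathbb E[v_p(1)]$, $m_d=\mathbb E[v_d(1)]$, and $\mathbb E[v_d(1)^2]<\infty$. Fix a token budget $b\ge 1$ and integers $t_k\ge 1$ ($0\le k\le b$), the number of slots needed to process a batch of $k$ tokens. The state $X(n)$ consists of the remaining processing time $R(n)$ of the current batch and the list, in order of arrival, of the triples $(P_i(n),D_i(n),Z_i(n))$, $i\in\mathcal Q_n$: numbers of prefill and decode tokens not yet loaded into a batch, and feature, of each request present. A scheduling algorithm $\pi$ maps each state with $R=0$ to numbers $(\delta_i^p,\delta_i^d)_{i\in\mathcal Q}$ of loaded tokens such that $\delta_i^p\le P_i$, $\delta_i^d\le 1$, $\delta_i^d=0$ if $P_i>0$, and $b':=\sum_i(\delta_i^p+\delta_i^d)\le b$.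 If $R(n)=0$, the loaded tokens are subtracted from the $P_i,D_i$, requests with no decode tokens left are removed, and $R(n+1)=t_{b'}-1$; if $R(n)>0$, nothing is loaded and $R(n+1)=R(n)-1$. The requests that arrive in slot $n$ are then appended to the list. The chain starts in a fixed state in which every request present has at least one decode token left; its state space is the set of states that it visits with positive probability, and the requirements on $\pi$ are imposed at these states. The algorithm is *work-conserving* if $b'=\min\bigl(b,\sum_{i\in\mathcal Q}(P_i+\mathbf 1\{P_i=0\})\bigr)$ in every state with $R=0$. For integers $K_p,K_d\ge 1$ it is *$(K_p,K_d)$-FCFS* if prefill tokens are loaded only from the $K_p$ oldest requests with $P_i>0$, and decode tokens only from the $K_d$ oldest requests with $P_i=0$. **Theorem.** (a) If $\lambda(m_p+m_d)<b/t_b$, then under every work-conserving $(K_p,K_d)$-FCFS scheduling algorithm for which the chain is irreducible, the chain is positive recurrent. (b) If $\lambda(m_p+m_d)>b/t_b$, and $b/t_b$ is the maximal token processing rate, i.e. $k/t_k\le b/t_b$ for all $k\le b$, then under every scheduling algorithm $$\mathbb P\Bigl\{\lim_{n\to\infty}|X(n)|=\infty\Bigr\}=1,\qquad |X(n)|=\sum_{i\in\mathcal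 Q_n}(P_i(n)+D_i(n)).$$ -/

import Mathlib

open MeasureTheory ProbabilityTheory Filter
open scoped ENNReal

namespace LLMEngine

/-- A request that is present in the system: its numbers of unprocessed (not yet loaded) prefill
and decode tokens, and its feature. -/
@[ext] structure Request (F : Type*) where
  prefill : ℕ
  decode : ℕ
  feature : F

/-- A system state at the beginning of a slot: the remaining processing time of the current batch
and the list of the requests that have not departed, the oldest one first. -/
@[ext] structure State (F : Type*) where
  remaining : ℕ
  queue : List (Request F)

/-- The numbers of prefill and decode tokens of one request that are loaded into a batch. -/
structure Load where
  prefill : ℕ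
  decode : ℕ

/-- A (not necessarily feasible) batch selection rule: it maps a state to a load for every request
in its queue. Only its values at states with `remaining = 0` are used. -/
abbrev Policy (F : Type*) := (x : State F) → Fin x.queue.length → Load

variable {F Ω : Type*}

/-- Every request that is present still has at least one decode token. -/
def State.Valid (x : State F) : Prop := ∀ q ∈ x.queue, 1 ≤ q.decode

/-- The total number of unprocessed tokens. -/
def State.size (x : State F) : ℕ := (x.queue.map fun q => q.prefill + q.decode).sum

/-- The largest number of tokens that could be loaded if there were no token budget: all prefill
tokens of the requests in the prefill phase, one token of each request in the decode phase. -/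
def State.available (x : State F) : ℕ :=
  (x.queue.map fun q => q.prefill + if q.prefill = 0 then 1 else 0).sum

/-- The token load of the batch selected in state `x`. -/
def tokenLoad (π : Policy F) (x : State F) : ℕ := ∑ i, ((π x i).decode + (π x i).prefill)

/-- The queue after the batch selected in state `x` has been loaded: the loaded tokens are
subtracted and the requests without remaining decode tokens are removed. -/
def loadedQueue (π : Policy F) (x : State F) : List (Request F) :=
  (List.ofFn fun i : Fin x.queue.length =>
    ({ prefill := (x.queue.get i).prefill - (π x i).prefill
       decode := (x.queue.get i).decode - (π x i).decode
       feature := (x.queue.get i).feature } : Request F)).filter fun q => q.decode ≠ 0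

/-- One slot of the dynamics; `new` is the list of the requests that arrive in the slot, and
`t k` is the number of slots needed to process a batch with `k` tokens. -/
def step (t : ℕ → ℕ) (π : Policy F) (x : State F) (new : List (Request F)) : State F :=
  if x.remaining = 0 then
    { remaining := t (tokenLoad π x) - 1, queue := loadedQueue π x ++ new }
  else
    { remaining := x.remaining - 1, queue := x.queue ++ new }

/-- The requests that arrive in slot `n`. Slots and requests are numbered from `0`; there are
`a n` arrivals in slot `n`, and request `i` has `vp i` prefill tokens, `vd i` decode tokens and
feature `z i`. -/
def arrivals (a vp vd : ℕ → Ω → ℕ) (z : ℕ → Ω → F) (n : ℕ) (ω : Ω) : List (Request F) :=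
  (List.range (a n ω)).map fun j =>
    let i := (∑ k ∈ Finset.range n, a k ω) + j
    { prefill := vp i ω, decode := vd i ω, feature := z i ω }

/-- The chain of system states started at `x`. -/
def chain (t : ℕ → ℕ) (π : Policy F) (a vp vd : ℕ → Ω → ℕ) (z : ℕ → Ω → F) (x : State F) :
    ℕ → Ω → State F
  | 0, _ => x
  | n + 1, ω => step t π (chain t π a vp vd z x n ω) (arrivals a vp vd z n ω)

/-- The states that a family `X x` of processes (`X x` being the chain started at `x`) visits with
positive probability when it is started at `x₀`. -/
def stateSpace [MeasurableSpace Ω] (μ : Measure Ω) (X : State F → ℕ → Ω → State F)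
    (x₀ : State F) : Set (State F) :=
  {y | ∃ n, 0 < μ {ω | X x₀ n ω = y}}

/-- Any two states in `S` communicate. -/
def IsIrreducibleOn [MeasurableSpace Ω] (μ : Measure Ω) (X : State F → ℕ → Ω → State F)
    (S : Set (State F)) : Prop :=
  ∀ x ∈ S, ∀ y ∈ S, ∃ n, 0 < μ {ω | X x n ω = y}

/-- The time of the first return to `x` of the chain started at `x` (`∞` if there is none). -/
noncomputable def returnTime (X : State F → ℕ → Ω → State F) (x : State F) (ω : Ω) : ℝ≥0∞ :=
  ⨅ (n : ℕ) (_ : 1 ≤ n ∧ X x n ω = x), (n : ℝ≥0∞)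

/-- Every state in `S` has a finite expected return time. -/
def IsPositiveRecurrentOn [MeasurableSpace Ω] (μ : Measure Ω) (X : State F → ℕ → Ω → State F)
    (S : Set (State F)) : Prop :=
  ∀ x ∈ S, ∫⁻ ω, returnTime X x ω ∂μ < ∞

/-- `π` is a scheduling algorithm with token budget `b` on the state space `S`: its batches are
feasible. -/
def IsSchedulingAlgorithm (b : ℕ) (π : Policy F) (S : Set (State F)) : Prop :=
  ∀ x ∈ S, x.remaining = 0 →
    (∀ i : Fin x.queue.length,
      (0 < (x.queue.get i).prefill → (π x i).decode = 0) ∧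
      (π x i).prefill ≤ (x.queue.get i).prefill ∧
      (π x i).decode ≤ 1) ∧
    tokenLoad π x ≤ b

/-- `π` never wastes token budget: its batch is full whenever `b` tokens are available, and
contains all the available tokens if there are fewer. -/
def IsWorkConserving (b : ℕ) (π : Policy F) (S : Set (State F)) : Prop :=
  ∀ x ∈ S, x.remaining = 0 → tokenLoad π x = min b x.available

/-- Prefill tokens are loaded only from the `Kp` oldest requests in the prefill phase, decode
tokens only from the `Kd` oldest requests in the decode phase. -/
def IsFCFS (Kp Kd : ℕ) (π : Policy F) (S : Set (State F)) : Prop :=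
  ∀ x ∈ S, x.remaining = 0 → ∀ i : Fin x.queue.length,
    (0 < (π x i).prefill →
      (Finset.univ.filter fun j => j < i ∧ 0 < (x.queue.get j).prefill).card < Kp) ∧
    (0 < (π x i).decode →
      (Finset.univ.filter fun j => j < i ∧ (x.queue.get j).prefill = 0).card < Kd)

end LLMEngine

/-! The arrival lists of successive slots are i.i.d., so the state follows a random recursion `X
(n+1) = f (X n) (Y n)` with i.i.d. inputs (`isIIDWithLaw_blocks`).

Part (a) is Foster's criterion (`isPositiveRecurrent_of_drift`) with the function `State.lyapunov`:
every request contributes `h (P + D) + N ^ 2`, where `N = D + 1{P > 0}`, and the running batch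
contributes `κ R`. A busy slot releases `κ`. A full batch removes `h b` from the linear part and
costs `κ (t b - 1)`, a net decrease of at least `κ` if `κ t_b ≤ h b`. If there are fewer than `b`
available tokens, all of them are loaded, so each `N` drops by one and the squares fall by at least
the total number of decode tokens; outside a finite set this number is large, because fewer than `b`
prefill tokens are left. Arrivals add `α = λ (h m + m₂)` on average, where `m = m_p + m_d` and `m₂ =
E (v_d + 1) ^ 2`. Since `λ m t_b < b`, a large `h` leaves room for an integer `κ` with `α + 1 ≤ κ`
and `κ t_b ≤ h b`.

Part (b) is pathwise: with `ρ = b / t_b`, the quantity `|X| + ρ R + ρ n` grows by at least the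
arriving tokens in every slot (`size_step_ge`), and `R` is bounded. By the strong law, applied to
the arrival counts and to the request sizes, the arriving tokens outgrow `ρ n`. -/

namespace LLMEngine

/-! ### Finite histories of a random sequence. -/

section History

variable {Ω : Type*}

/-- The first `n` values of a sequence of random variables. -/
def history {L : Type*} (Y : ℕ → Ω → L) (n : ℕ) (ω : Ω) : List L :=
  (List.range n).map fun k => Y k ω

theorem history_succ {L : Type*} (Y : ℕ → Ω → L) (n : ℕ) (ω : Ω) :
    history Y (n + 1) ω = history Y n ω ++ [Y n ω] := by
  simp [history, List.range_succ]

theorem length_history {L : Type*} (Y : ℕ → Ω → L) (n : ℕ) (ω : Ω) :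
    (history Y n ω).length = n := by
  simp [history]

end History

/-! ### Discrete i.i.d. sequences described by their probability mass function. -/

section Discrete

variable {Ω : Type*} [MeasurableSpace Ω] {μ : Measure Ω}

/-- The integral of a function of a discrete random variable. -/
theorem lintegral_comp_eq_tsum {β : Type*} [Countable β] {Y : Ω → β}
    (hY : ∀ y, MeasurableSet {ω | Y ω = y}) (g : β → ℝ≥0∞) :
    ∫⁻ ω, g (Y ω) ∂μ = ∑' y, μ {ω | Y ω = y} * g y := by
  let _ : MeasurableSpace β := ⊤
  have _ : MeasurableSingletonClass β := ⟨fun _ => trivial⟩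
  have hm : Measurable Y := measurable_to_countable' hY
  have hg : Measurable g := fun _ _ => trivial
  rw [← lintegral_map hg hm, lintegral_countable']
  refine tsum_congr fun y => ?_
  rw [Measure.map_apply hm (measurableSet_singleton y), mul_comm]
  rfl

theorem measurableSet_history_eq {L : Type*} {Y : ℕ → Ω → L}
    (hY : ∀ n y, MeasurableSet {ω | Y n ω = y}) (n : ℕ) (hs : List L) :
    MeasurableSet {ω | history Y n ω = hs} := by
  induction n generalizing hs with
  | zero => simp [history]
  | succ n ih =>
    rcases List.eq_nil_or_concat hs with rfl | ⟨hs, l, rfl⟩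
    · simp [history_succ]
    · simp only [List.concat_eq_append, history_succ, List.append_singleton_inj]
      exact (ih hs).inter (hY n l)

/-- `Y` is a sequence of independent discrete random variables with probability mass function
`ν`. -/
structure IsIIDWithLaw {L : Type*} (μ : Measure Ω) (Y : ℕ → Ω → L) (ν : L → ℝ≥0∞) : Prop where
  measurableSet_eq : ∀ n y, MeasurableSet {ω | Y n ω = y}
  history_eq : ∀ hs : List L, μ {ω | history Y hs.length ω = hs} = (hs.map ν).prod

theorem isIIDWithLaw_of_iIndepFun [IsProbabilityMeasure μ] {L : Type*} [MeasurableSpace L]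
    [MeasurableSingletonClass L] {Y : ℕ → Ω → L} (hm : ∀ n, Measurable (Y n))
    (hi : iIndepFun Y μ) (hd : ∀ n, IdentDistrib (Y n) (Y 0) μ μ) :
    IsIIDWithLaw μ Y (fun y => μ {ω | Y 0 ω = y}) where
  measurableSet_eq n y := hm n (measurableSet_singleton y)
  history_eq hs := by
    have hset : {ω | history Y hs.length ω = hs} =
        ⋂ i ∈ (Finset.univ : Finset (Fin hs.length)), Y i ⁻¹' {hs.get i} := by
      ext ω
      simp only [Set.mem_ofPred_eq, Set.mem_iInter, Set.mem_preimage, Set.mem_singleton_iff,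
        Finset.mem_univ, forall_true_left]
      constructor
      · intro h i
        have := List.getElem_of_eq h.symm i.2
        simpa [history] using this.symm
      · intro h
        refine List.ext_getElem (length_history _ _ _) fun i h1 h2 => ?_
        simpa [history] using h ⟨i, h2⟩
    have hi' : iIndepFun (fun i : Fin hs.length => Y i) μ := hi.precomp Fin.val_injective
    rw [hset, hi'.measure_inter_preimage_eq_mul Finset.univ
      (sets := fun i => {hs.get i}) (fun i _ => measurableSet_singleton _)]
    have : ∀ i : Fin hs.length, μ (Y i ⁻¹' {hs.get i}) = μ {ω | Y 0 ω = hs.get i} := fun i =>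
      (hd i).measure_mem_eq (measurableSet_singleton _)
    simp only [this]
    conv_rhs => rw [← List.ofFn_get hs]
    rw [List.map_ofFn, List.prod_ofFn]
    rfl

variable {L : Type*} {Y : ℕ → Ω → L} {ν : L → ℝ≥0∞}

theorem IsIIDWithLaw.measure_eq (hY : IsIIDWithLaw μ Y ν) (l : L) :
    μ {ω | Y 0 ω = l} = ν l := by
  simpa [history] using hY.history_eq [l]

theorem IsIIDWithLaw.lintegral_eq [Countable L] (hY : IsIIDWithLaw μ Y ν) (g : L → ℝ≥0∞) :
    ∫⁻ ω, g (Y 0 ω) ∂μ = ∑' l, ν l * g l := by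
  rw [lintegral_comp_eq_tsum (hY.measurableSet_eq 0)]
  simp only [hY.measure_eq]

theorem IsIIDWithLaw.tsum_eq_one [IsProbabilityMeasure μ] [Countable L]
    (hY : IsIIDWithLaw μ Y ν) : ∑' l, ν l = 1 := by
  simpa using (hY.lintegral_eq 1).symm

/-- The next value is independent of the history. -/
theorem IsIIDWithLaw.lintegral_history_succ [Countable L] (hY : IsIIDWithLaw μ Y ν) (n : ℕ)
    (G : List L → L → ℝ≥0∞) :
    ∫⁻ ω, G (history Y n ω) (Y n ω) ∂μ = ∫⁻ ω, ∑' l, ν l * G (history Y n ω) l ∂μ := by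
  have hm := measurableSet_history_eq hY.measurableSet_eq n
  rw [lintegral_comp_eq_tsum hm (fun hs => ∑' l, ν l * G hs l)]
  have h2 := lintegral_comp_eq_tsum (μ := μ) (Y := fun ω => (history Y n ω, Y n ω))
    (fun y => by
      simp only [Prod.ext_iff]
      exact (hm y.1).inter (hY.measurableSet_eq n y.2)) (fun p => G p.1 p.2)
  rw [h2, ENNReal.tsum_prod']
  refine tsum_congr fun hs => ?_
  rw [← ENNReal.tsum_mul_left]
  refine tsum_congr fun l => ?_
  rw [← mul_assoc]
  congr 1
  -- A list of the wrong length has probability zero on both sides, so the product formula is needed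
  -- only for length `n`.
  by_cases hn : hs.length = n
  · subst hn
    have h3 := hY.history_eq (hs ++ [l])
    simp only [List.length_append, List.length_singleton, history_succ,
      List.append_singleton_inj, List.map_append, List.prod_append, ← hY.history_eq hs] at h3
    simpa using h3
  · have e1 : ∀ ω, history Y n ω ≠ hs := fun ω h => hn (by rw [← h, length_history])
    simp [e1]

end Discrete

/-! ### Killed transition operators, hitting times and the analytic form of Foster's criterion. -/

section Recursion

variable {Ω S L : Type*} (f : S → L → S) (ν : L → ℝ≥0∞) (A : Set S)

open Classical in
/-- The transition operator, killed on `A`, of the chain `x ↦ f x l` with `l` drawn from `ν`. -/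
noncomputable def killedOp (g : S → ℝ≥0∞) (x : S) : ℝ≥0∞ :=
  ∑' l, ν l * if f x l ∈ A then 0 else g (f x l)

variable {f ν A}

theorem killedOp_add (g₁ g₂ : S → ℝ≥0∞) :
    killedOp f ν A (g₁ + g₂) = killedOp f ν A g₁ + killedOp f ν A g₂ := by
  funext x
  simp only [killedOp, Pi.add_apply, ← ENNReal.tsum_add, ← mul_add]
  refine tsum_congr fun l => ?_
  split_ifs <;> simp

theorem killedOp_const_mul (c : ℝ≥0∞) (g : S → ℝ≥0∞) (x : S) :
    killedOp f ν A (fun y => c * g y) x = c * killedOp f ν A g x := by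
  simp only [killedOp, ← ENNReal.tsum_mul_left]
  refine tsum_congr fun l => ?_
  split_ifs
  · simp
  · ring

theorem killedOp_sum {ι : Type*} (s : Finset ι) (g : ι → S → ℝ≥0∞) :
    killedOp f ν A (∑ i ∈ s, g i) = ∑ i ∈ s, killedOp f ν A (g i) := by
  classical
  induction s using Finset.induction_on with
  | empty => funext x; simp [killedOp]
  | insert i s hi ih => rw [Finset.sum_insert hi, Finset.sum_insert hi, killedOp_add, ih]

/-- Monotonicity of the killed transition operator on a closed set of states. -/
theorem killedOp_mono {T : Set S} (hT : ∀ x ∈ T, ∀ l, ν l ≠ 0 → f x l ∈ T) {g₁ g₂ : S → ℝ≥0∞}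
    (h : ∀ x ∈ T, g₁ x ≤ g₂ x) {x : S} (hx : x ∈ T) :
    killedOp f ν A g₁ x ≤ killedOp f ν A g₂ x := by
  refine ENNReal.tsum_le_tsum fun l => ?_
  rcases eq_or_ne (ν l) 0 with h0 | h0
  · simp [h0]
  · gcongr
    split_ifs
    · exact le_rfl
    · exact h _ (hT x hx l h0)

theorem killedOp_le (g : S → ℝ≥0∞) (x : S) :
    killedOp f ν A g x ≤ ∑' l, ν l * g (f x l) := by
  refine ENNReal.tsum_le_tsum fun l => ?_
  gcongr
  split_ifs <;> simp

theorem killedOp_empty (g : S → ℝ≥0∞) (x : S) :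
    killedOp f ν ∅ g x = ∑' l, ν l * g (f x l) := by
  simp [killedOp]

theorem killedOp_iterate_one_le (hν : ∑' l, ν l = 1) (n : ℕ) (x : S) :
    (killedOp f ν A)^[n] 1 x ≤ 1 := by
  induction n generalizing x with
  | zero => simp
  | succ n ih =>
    rw [Function.iterate_succ_apply']
    refine (killedOp_mono (T := Set.univ) (by simp) (g₂ := 1) (fun y _ => ih y) trivial).trans ?_
    refine (killedOp_le _ _).trans ?_
    simp [hν]

theorem killedOp_iterate_one_antitone (hν : ∑' l, ν l = 1) (x : S) :
    Antitone fun n => (killedOp f ν A)^[n] 1 x := by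
  refine antitone_nat_of_succ_le fun n => ?_
  induction n generalizing x with
  | zero => exact killedOp_iterate_one_le hν 1 x
  | succ n ih =>
    have h := killedOp_mono (f := f) (A := A) (ν := ν) (T := Set.univ) (by simp) (fun y _ => ih y)
      (Set.mem_univ x)
    simpa only [Function.iterate_succ_apply'] using h

/-- A chain that may be in `A` at time `n + 1` may have been killed by then. -/
theorem killedOp_iterate_add_le (hν : ∑' l, ν l = 1) (n : ℕ) (x : S) :
    (killedOp f ν A)^[n + 1] 1 x + (killedOp f ν ∅)^[n + 1] (A.indicator 1) x ≤ 1 := by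
  classical
  have key : ∀ g₁ g₂ : S → ℝ≥0∞,
      (∀ y, (if y ∈ A then 0 else g₁ y) + g₂ y ≤ 1) →
      ∀ y, killedOp f ν A g₁ y + killedOp f ν ∅ g₂ y ≤ 1 := by
    intro g₁ g₂ h y
    rw [killedOp_empty, killedOp, ← ENNReal.tsum_add, ← hν]
    refine ENNReal.tsum_le_tsum fun l => ?_
    rw [← mul_add]
    exact mul_le_of_le_one_right' (by convert h (f y l))
  induction n generalizing x with
  | zero =>
    refine key _ _ (fun y => ?_) x
    by_cases hy : y ∈ A <;> simp [hy]
  | succ n ih =>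
    rw [Function.iterate_succ_apply', Function.iterate_succ_apply' _ (n + 1)]
    refine key _ _ (fun y => ?_) x
    refine le_trans ?_ (ih y)
    gcongr
    split_ifs <;> simp

theorem killedOp_iterate_one_lt (hν : ∑' l, ν l = 1) {n : ℕ} {x : S}
    (h : 0 < (killedOp f ν ∅)^[n + 1] (A.indicator 1) x) :
    (killedOp f ν A)^[n + 1] 1 x < 1 := by
  have h1 := killedOp_iterate_add_le (A := A) (f := f) hν n x
  refine lt_of_lt_of_le ?_ h1
  exact ENNReal.lt_add_right
    (ne_top_of_le_ne_top ENNReal.one_ne_top (killedOp_iterate_one_le hν _ _)) h.ne'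

/-- A superharmonic-type bound for the expected time before killing. -/
theorem sum_killedOp_iterate_le {T : Set S} (hT : ∀ x ∈ T, ∀ l, ν l ≠ 0 → f x l ∈ T)
    {V : S → ℝ≥0∞} (hV : ∀ x ∈ T, killedOp f ν A V x + 1 ≤ V x) (n : ℕ) :
    ∀ x ∈ T, ∑ k ∈ Finset.range n, (killedOp f ν A)^[k] 1 x ≤ V x := by
  induction n with
  | zero => simp
  | succ n ih =>
    intro x hx
    -- The term `k = 0` is the `1` in `hV`; the other terms are one application of the operator to
    -- the shorter sum.
    rw [Finset.sum_range_succ']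
    refine le_trans ?_ (hV x hx)
    have : ∑ k ∈ Finset.range n, (killedOp f ν A)^[k + 1] 1 x =
        killedOp f ν A (∑ k ∈ Finset.range n, (killedOp f ν A)^[k] 1) x := by
      simp only [Function.iterate_succ_apply', killedOp_sum, Finset.sum_apply]
    rw [this]
    gcongr
    · exact killedOp_mono hT (fun y hy => by simpa using ih y hy) hx
    · simp

/-- Foster's criterion: a drift condition outside a finite set from whose points `A` can be
reached bounds the expected time to reach `A`. -/
theorem tsum_killedOp_iterate_lt_top (hν : ∑' l, ν l = 1) {T : Set S}
    (hT : ∀ x ∈ T, ∀ l, ν l ≠ 0 → f x l ∈ T) {V : S → ℝ≥0∞} (hVtop : ∀ x, V x ≠ ∞)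
    {C : Set S} (hC : C.Finite) {K : ℝ≥0∞} (hK : K ≠ ∞)
    (hdrift : ∀ x ∈ T, x ∉ C → ∑' l, ν l * V (f x l) + 1 ≤ V x)
    (hdriftC : ∀ x ∈ T, ∑' l, ν l * V (f x l) + 1 ≤ V x + K)
    (hreach : ∀ x ∈ T, ∃ n, (killedOp f ν A)^[n] 1 x < 1) {x : S} (hx : x ∈ T) :
    ∑' n, (killedOp f ν A)^[n] 1 x < ∞ := by
  set u : ℕ → S → ℝ≥0∞ := fun n => (killedOp f ν A)^[n] 1 with hu
  -- `u n` is the probability of surviving `n` steps. It decreases in `n` and `C` is finite, so one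
  -- `N` and one bound `θ < 1` serve all points of `C ∩ T`.
  have hN : ∃ N, ∀ c ∈ C ∩ T, u N c < 1 := by
    have hev : ∀ c ∈ C ∩ T, ∀ᶠ N in atTop, u N c < 1 := fun c hc => by
      obtain ⟨n, hn⟩ := hreach c hc.2
      filter_upwards [eventually_ge_atTop n] with N hN
      exact (killedOp_iterate_one_antitone hν c hN).trans_lt hn
    exact ((hC.inter_of_left T).eventually_all.2 hev).exists
  obtain ⟨N, hN⟩ := hN
  have hθ : ∃ θ < 1, ∀ c ∈ C ∩ T, u N c ≤ θ := by
    have hev : ∀ c ∈ C ∩ T, ∀ᶠ θ in nhdsWithin (1 : ℝ≥0∞) (Set.Iio 1), u N c ≤ θ := fun c hc => by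
      refine (eventually_nhdsWithin_of_eventually_nhds ?_)
      exact (eventually_gt_nhds (hN c hc)).mono fun _ h => le_of_lt h
    have : (nhdsWithin (1 : ℝ≥0∞) (Set.Iio 1)).NeBot := nhdsLT_neBot_of_exists_lt ⟨0, one_pos⟩
    obtain ⟨θ, h1, h2⟩ :=
      (((hC.inter_of_left T).eventually_all.2 hev).and self_mem_nhdsWithin).exists
    exact ⟨θ, h2, h1⟩
  obtain ⟨θ, hθ1, hθ⟩ := hθ
  set ε : ℝ≥0∞ := 1 - θ with hε
  have hε0 : ε ≠ 0 := (tsub_pos_of_lt hθ1).ne'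
  have hεtop : ε ≠ ∞ := ne_top_of_le_ne_top ENNReal.one_ne_top tsub_le_self
  have hule : ∀ n y, u n y ≤ 1 := fun n y => killedOp_iterate_one_le hν n y
  set w : S → ℝ≥0∞ := ∑ k ∈ Finset.range N, u k with hw
  -- The operator shifts the sum by one index. Hence `w` never increases in mean, and on `C` it
  -- loses at least `ε = 1 - θ`.
  have hQw : ∀ y, killedOp f ν A w y + 1 = w y + u N y := by
    intro y
    have h1 : killedOp f ν A w = ∑ k ∈ Finset.range N, u (k + 1) := by
      rw [hw, killedOp_sum]
      refine Finset.sum_congr rfl fun k _ => ?_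
      simp only [hu, Function.iterate_succ_apply']
    have h2 := Finset.sum_range_succ' (fun k => u k y) N
    have h3 := Finset.sum_range_succ (fun k => u k y) N
    rw [h1, hw, Finset.sum_apply, Finset.sum_apply]
    rw [← h3, h2]
    simp [hu]
  have hQw1 : ∀ y, killedOp f ν A w y ≤ w y := fun y => by
    have := hQw y
    have h2 : killedOp f ν A w y + 1 ≤ w y + 1 := by rw [this]; gcongr; exact hule N y
    exact (ENNReal.add_le_add_iff_right ENNReal.one_ne_top).1 h2
  have hQwC : ∀ c ∈ C ∩ T, killedOp f ν A w c + ε ≤ w c := fun c hc => by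
    have h2 : killedOp f ν A w c + ε + θ ≤ w c + θ := by
      rw [add_assoc, hε, tsub_add_cancel_of_le hθ1.le, hQw c]
      gcongr
      exact hθ c hc
    exact (ENNReal.add_le_add_iff_right (ne_top_of_lt hθ1)).1 h2
  have hwtop : ∀ y, w y ≠ ∞ := fun y => by
    rw [hw, Finset.sum_apply]
    exact ENNReal.sum_ne_top.2 fun k _ => ne_top_of_le_ne_top ENNReal.one_ne_top (hule k y)
  -- With this factor the loss `c₀ ε` of `c₀ w` on `C` equals the possible excess `K` of the drift
  -- of `V`, so `W` has drift at most `-1` on all of `T`.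
  set c₀ : ℝ≥0∞ := K / ε with hc₀
  have hc₀top : c₀ ≠ ∞ := ENNReal.div_ne_top hK hε0
  set W : S → ℝ≥0∞ := V + fun y => c₀ * w y with hWdef
  have hWdrift : ∀ y ∈ T, killedOp f ν A W y + 1 ≤ W y := by
    intro y hy
    rw [hWdef, killedOp_add, Pi.add_apply, Pi.add_apply, killedOp_const_mul]
    by_cases hyC : y ∈ C
    · have h1 : killedOp f ν A V y + 1 ≤ V y + K :=
        (add_le_add_left (killedOp_le V y) 1).trans (hdriftC y hy)
      have h2 : c₀ * killedOp f ν A w y + K ≤ c₀ * w y := by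
        have h3 := hQwC y ⟨hyC, hy⟩
        calc c₀ * killedOp f ν A w y + K = c₀ * (killedOp f ν A w y + ε) := by
              rw [mul_add, hc₀, ENNReal.div_mul_cancel hε0 hεtop]
          _ ≤ _ := by gcongr
      refine (ENNReal.add_le_add_iff_right hK).1 ?_
      calc _ = (killedOp f ν A V y + 1) + (c₀ * killedOp f ν A w y + K) := by ring
        _ ≤ (V y + K) + c₀ * w y := add_le_add h1 h2
        _ = _ := by ring
    · have h1 : killedOp f ν A V y + 1 ≤ V y :=
        (add_le_add_left (killedOp_le V y) 1).trans (hdrift y hy hyC)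
      calc _ = (killedOp f ν A V y + 1) + c₀ * killedOp f ν A w y := by ring
        _ ≤ V y + c₀ * w y := by gcongr; exact hQw1 y
  have hWx : W x ≠ ∞ := by
    rw [hWdef]
    exact ENNReal.add_ne_top.2 ⟨hVtop x, ENNReal.mul_ne_top hc₀top (hwtop x)⟩
  refine lt_of_le_of_lt ?_ hWx.lt_top
  exact ENNReal.tsum_le_of_sum_range_le fun n => sum_killedOp_iterate_le hT hWdrift n x hx

variable {Y : ℕ → Ω → L} {X : ℕ → Ω → S} {x : S}

/-- The state depends only on the history, which takes countably many values when `L` is countable;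
events of the chain are then measurable without a σ-algebra on `S`. -/
theorem eq_foldl_history (h0 : ∀ ω, X 0 ω = x) (hX : ∀ n ω, X (n + 1) ω = f (X n ω) (Y n ω))
    (n : ℕ) (ω : Ω) : X n ω = (history Y n ω).foldl f x := by
  induction n with
  | zero => simp [history, h0]
  | succ n ih => simp [history_succ, hX, ih]

variable [MeasurableSpace Ω] {μ : Measure Ω}

theorem measurableSet_recursion_mem [Countable L] (hY : IsIIDWithLaw μ Y ν)
    (h0 : ∀ ω, X 0 ω = x) (hX : ∀ n ω, X (n + 1) ω = f (X n ω) (Y n ω)) (n : ℕ) (A : Set S) :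
    MeasurableSet {ω | X n ω ∈ A} := by
  have : {ω | X n ω ∈ A} =
      ⋃ hs ∈ {hs : List L | hs.foldl f x ∈ A}, {ω | history Y n ω = hs} := by
    ext ω
    simp [eq_foldl_history h0 hX]
  rw [this]
  exact MeasurableSet.biUnion (Set.to_countable _)
    fun hs _ => measurableSet_history_eq hY.measurableSet_eq n hs

open Classical in
-- Integrating out the last input, given the history, replaces `g` by `killedOp f ν A g`; this is
-- why the induction runs over all `g`. Time `0` is exempt from killing, so that a chain started in
-- `A` is followed until its return.
theorem lintegral_avoid [IsProbabilityMeasure μ] [Countable L] (hY : IsIIDWithLaw μ Y ν)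
    (h0 : ∀ ω, X 0 ω = x) (hX : ∀ n ω, X (n + 1) ω = f (X n ω) (Y n ω)) (n : ℕ)
    (g : S → ℝ≥0∞) :
    ∫⁻ ω, (if ∀ k, 1 ≤ k → k ≤ n → X k ω ∉ A then g (X n ω) else 0) ∂μ =
      (killedOp f ν A)^[n] g x := by
  induction n generalizing g with
  | zero =>
    have : ∀ ω, (∀ k, 1 ≤ k → k ≤ 0 → X k ω ∉ A) := fun ω k h1 h2 => by omega
    exact (lintegral_congr fun ω => if_pos (this ω)).trans (by simp [h0])
  | succ n ih =>
    rw [Function.iterate_succ_apply, ← ih]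
    set G : List L → Prop := fun hs => ∀ k, 1 ≤ k → k ≤ n → (hs.take k).foldl f x ∉ A with hG
    have hGX : ∀ ω, (∀ k, 1 ≤ k → k ≤ n → X k ω ∉ A) ↔ G (history Y n ω) := by
      intro ω
      refine forall_congr' fun k => forall_congr' fun _ => forall_congr' fun hk => ?_
      rw [eq_foldl_history h0 hX k ω]
      simp [history, ← List.map_take, List.take_range, hk]
    have hlast : ∀ ω, (∀ k, 1 ≤ k → k ≤ n + 1 → X k ω ∉ A) ↔
        ((∀ k, 1 ≤ k → k ≤ n → X k ω ∉ A) ∧ X (n + 1) ω ∉ A) := by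
      intro ω
      constructor
      · exact fun h => ⟨fun k h1 h2 => h k h1 (by omega), h _ (by omega) le_rfl⟩
      · rintro ⟨h1, h2⟩ k hk hk'
        rcases Nat.lt_or_ge n k with h | h
        · obtain rfl : k = n + 1 := by omega
          exact h2
        · exact h1 k hk h
    have h1 := hY.lintegral_history_succ n (fun hs l =>
      if G hs then (if f (hs.foldl f x) l ∈ A then 0 else g (f (hs.foldl f x) l)) else 0)
    simp only [← hGX, ← eq_foldl_history h0 hX] at h1
    refine Eq.trans ?_ (h1.trans ?_)
    · refine lintegral_congr fun ω => ?_
      simp only [hlast, hX]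
      split_ifs <;> simp_all
    · refine lintegral_congr fun ω => ?_
      split_ifs
      · rfl
      · simp

theorem measure_recursion_mem [IsProbabilityMeasure μ] [Countable L] (hY : IsIIDWithLaw μ Y ν)
    (h0 : ∀ ω, X 0 ω = x) (hX : ∀ n ω, X (n + 1) ω = f (X n ω) (Y n ω)) (n : ℕ) (A : Set S) :
    μ {ω | X n ω ∈ A} = (killedOp f ν ∅)^[n] (A.indicator 1) x := by
  rw [← lintegral_avoid hY h0 hX, ← lintegral_indicator_one
    (measurableSet_recursion_mem hY h0 hX n A)]
  refine lintegral_congr fun ω => ?_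
  simp [Set.indicator]

/-- A hitting time `τ` satisfies `τ = ∑ n, 1{τ > n}`, and the `n`-th summand has expectation
`(killedOp f ν {y})^[n] 1 x`. -/
theorem lintegral_returnTime_le [IsProbabilityMeasure μ] [Countable L] (hY : IsIIDWithLaw μ Y ν)
    (h0 : ∀ ω, X 0 ω = x) (hX : ∀ n ω, X (n + 1) ω = f (X n ω) (Y n ω)) (y : S) :
    ∫⁻ ω, (⨅ (n : ℕ) (_ : 1 ≤ n ∧ X n ω = y), (n : ℝ≥0∞)) ∂μ ≤
      ∑' n, (killedOp f ν {y})^[n] 1 x := by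
  classical
  have hm : ∀ n, Measurable fun ω =>
      (if ∀ k, 1 ≤ k → k ≤ n → X k ω ∉ ({y} : Set S) then (1 : ℝ≥0∞) else 0) := by
    intro n
    refine Measurable.ite ?_ measurable_const measurable_const
    simp only [Set.ofPred_forall]
    refine MeasurableSet.iInter fun k => MeasurableSet.iInter fun _ => MeasurableSet.iInter fun _ =>
      (measurableSet_recursion_mem hY h0 hX k {y}).compl
  have h1 : ∀ n, (killedOp f ν {y})^[n] 1 x =
      ∫⁻ ω, (if ∀ k, 1 ≤ k → k ≤ n → X k ω ∉ ({y} : Set S) then (1 : ℝ≥0∞) else 0) ∂μ :=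
    fun n => (lintegral_avoid hY h0 hX n 1).symm
  simp only [h1]
  rw [← lintegral_tsum fun n => (hm n).aemeasurable]
  refine lintegral_mono fun ω => ?_
  by_cases hex : ∃ n, 1 ≤ n ∧ X n ω = y
  · refine (iInf₂_le (Nat.find hex) (Nat.find_spec hex)).trans ?_
    refine le_trans ?_ (ENNReal.sum_le_tsum (Finset.range (Nat.find hex)))
    have : ∀ n ∈ Finset.range (Nat.find hex),
        (if ∀ k, 1 ≤ k → k ≤ n → X k ω ∉ ({y} : Set S) then (1 : ℝ≥0∞) else 0) = 1 := by
      intro n hn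
      rw [if_pos]
      intro k hk hkn hXk
      exact Nat.find_min hex (lt_of_le_of_lt hkn (Finset.mem_range.1 hn)) ⟨hk, hXk⟩
    rw [Finset.sum_congr rfl this]
    simp
  · have : ∀ n, (if ∀ k, 1 ≤ k → k ≤ n → X k ω ∉ ({y} : Set S) then (1 : ℝ≥0∞) else 0) = 1 := by
      intro n
      rw [if_pos]
      exact fun k hk _ hXk => hex ⟨k, hk, hXk⟩
    simp only [this]
    simp

end Recursion

/-! ### Foster's criterion for the random recursion. -/

section Foster

variable {Ω S L : Type*} [MeasurableSpace Ω] {μ : Measure Ω} [IsProbabilityMeasure μ] [Countable L]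
  {f : S → L → S} {ν : L → ℝ≥0∞} {Y : ℕ → Ω → L}

/-- This makes the set of visited states closed under every step of positive probability. -/
theorem measure_recursion_succ_pos (hY : IsIIDWithLaw μ Y ν) {X : ℕ → Ω → S} {x : S}
    (h0 : ∀ ω, X 0 ω = x) (hX : ∀ n ω, X (n + 1) ω = f (X n ω) (Y n ω)) {n : ℕ} {y : S}
    (hy : 0 < μ {ω | X n ω = y}) {l : L} (hl : ν l ≠ 0) :
    0 < μ {ω | X (n + 1) ω = f y l} := by
  classical
  have hm := measurableSet_recursion_mem hY h0 hX n {y}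
  have h1 := measure_recursion_mem hY h0 hX (n + 1) {f y l}
  rw [Function.iterate_succ_apply, ← lintegral_avoid hY h0 hX] at h1
  change 0 < μ {ω | X (n + 1) ω ∈ ({f y l} : Set S)}
  rw [h1]
  have h2 : ν l * μ {ω | X n ω ∈ ({y} : Set S)} ≤ ∫⁻ ω,
      (if ∀ k, 1 ≤ k → k ≤ n → X k ω ∉ (∅ : Set S) then
        killedOp f ν ∅ (Set.indicator {f y l} 1) (X n ω) else 0) ∂μ := by
    rw [← lintegral_indicator_const hm]
    refine lintegral_mono fun ω => ?_
    by_cases hω : X n ω = y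
    · simp only [Set.mem_empty_iff_false, not_false_eq_true, implies_true, if_true]
      rw [killedOp_empty, Set.indicator_of_mem (by exact hω), hω]
      exact le_trans (by simp) (ENNReal.le_tsum l)
    · rw [Set.indicator_of_notMem (by exact hω)]
      exact zero_le
  exact lt_of_lt_of_le (ENNReal.mul_pos hl hy.ne') h2

/-- Foster's criterion for positive recurrence of an irreducible chain. -/
theorem isPositiveRecurrent_of_drift (hY : IsIIDWithLaw μ Y ν) {X : S → ℕ → Ω → S}
    (h0 : ∀ x ω, X x 0 ω = x) (hX : ∀ x n ω, X x (n + 1) ω = f (X x n ω) (Y n ω)) {x₀ : S}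
    {T : Set S} (hT : T = {y | ∃ n, 0 < μ {ω | X x₀ n ω = y}})
    (hirr : ∀ x ∈ T, ∀ y ∈ T, ∃ n, 0 < μ {ω | X x n ω = y})
    {V : S → ℝ≥0∞} (hVtop : ∀ x, V x ≠ ∞) {C : Set S} (hC : C.Finite) {K : ℝ≥0∞} (hK : K ≠ ∞)
    (hdrift : ∀ x ∈ T, x ∉ C → ∑' l, ν l * V (f x l) + 1 ≤ V x)
    (hdriftC : ∀ x ∈ T, ∑' l, ν l * V (f x l) + 1 ≤ V x + K) :
    ∀ x ∈ T, ∫⁻ ω, (⨅ (n : ℕ) (_ : 1 ≤ n ∧ X x n ω = x), (n : ℝ≥0∞)) ∂μ < ∞ := by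
  intro x hx
  have hclosed : ∀ x ∈ T, ∀ l, ν l ≠ 0 → f x l ∈ T := by
    rw [hT]
    rintro y ⟨n, hn⟩ l hl
    exact ⟨n + 1, measure_recursion_succ_pos hY (h0 x₀) (hX x₀) hn hl⟩
  refine (lintegral_returnTime_le hY (h0 x) (hX x) x).trans_lt ?_
  refine tsum_killedOp_iterate_lt_top hY.tsum_eq_one hclosed hVtop hC hK hdrift hdriftC
    (fun y hy => ?_) hx
  obtain ⟨l, hl⟩ : ∃ l, ν l ≠ 0 := by
    by_contra! h
    simpa [h] using hY.tsum_eq_one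
  -- Irreducibility may hold with `n = 0`. Taking one step before invoking it guarantees a visit at
  -- a time `n + 1 ≥ 1`.
  obtain ⟨n, hn⟩ := hirr _ (hclosed y hy l hl) x hx
  refine ⟨n + 1, killedOp_iterate_one_lt hY.tsum_eq_one ?_⟩
  change 0 < μ {ω | X (f y l) n ω ∈ ({x} : Set S)} at hn
  rw [measure_recursion_mem hY (h0 _) (hX _)] at hn
  rw [Function.iterate_succ_apply', killedOp_empty]
  exact (ENNReal.mul_pos hl hn.ne').trans_le
    (ENNReal.le_tsum (f := fun l => ν l * (killedOp f ν ∅)^[n] (Set.indicator {x} 1) (f y l)) l)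

end Foster

/-! ### The lists of arrivals per slot: independence and mean. -/

section Blocks

/-- The sequence `V` cut into consecutive blocks of lengths `a 0, a 1, …`. -/
def blocks {Ω E : Type*} (a : ℕ → Ω → ℕ) (V : ℕ → Ω → E) (n : ℕ) (ω : Ω) : List E :=
  (List.range (a n ω)).map fun j => V ((∑ k ∈ Finset.range n, a k ω) + j) ω

theorem history_add {Ω E : Type*} (V : ℕ → Ω → E) (m k : ℕ) (ω : Ω) :
    history V (m + k) ω = history V m ω ++ (List.range k).map fun j => V (m + j) ω := by
  simp [history, List.range_add, Function.comp_def]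

/-- The blocks start at random positions, but fixing their values fixes their lengths and thus the
positions. The event then concerns fixed coordinates of `a` and of `V` separately, and independence
applies. -/
theorem history_blocks_eq_iff {Ω E : Type*} (a : ℕ → Ω → ℕ) (V : ℕ → Ω → E) (ω : Ω)
    (hs : List (List E)) :
    history (blocks a V) hs.length ω = hs ↔
      history a hs.length ω = hs.map List.length ∧
        history V hs.flatten.length ω = hs.flatten := by
  induction hs using List.reverseRecOn with
  | nil => simp [history]
  | append_singleton hs l ih =>
    simp only [List.length_append, List.length_singleton, history_succ,
      List.append_singleton_inj, List.map_append, List.map_singleton, List.flatten_append,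
      List.flatten_singleton, history_add]
    rw [ih, (⟨fun h => List.append_inj h (length_history _ _ _), fun ⟨h, h'⟩ => by rw [h, h']⟩ :
      history V hs.flatten.length ω ++ (List.range l.length).map
        (fun j => V (hs.flatten.length + j) ω) = hs.flatten ++ l ↔ _ ∧ _)]
    have hsum : history a hs.length ω = hs.map List.length →
        ∑ k ∈ Finset.range hs.length, a k ω = hs.flatten.length := fun h => by
      rw [List.length_flatten, ← h, history, Finset.sum_range, ← List.sum_ofFn]
      congr 1
      refine List.ext_getElem (by simp) fun i h1 h2 => by simp
    have hb : history a hs.length ω = hs.map List.length → (blocks a V hs.length ω = l ↔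
        a hs.length ω = l.length ∧
          (List.range l.length).map (fun j => V (hs.flatten.length + j) ω) = l) := fun h => by
      rw [blocks, hsum h]
      constructor
      · intro h'
        have hl : a hs.length ω = l.length := by rw [← h']; simp
        exact ⟨hl, by rw [← hl, h']⟩
      · rintro ⟨h1, h2⟩
        rw [h1, h2]
    constructor
    · rintro ⟨⟨h1, h2⟩, h3⟩
      obtain ⟨h4, h5⟩ := (hb h1).1 h3
      exact ⟨⟨h1, h4⟩, h2, h5⟩
    · rintro ⟨⟨h1, h4⟩, h2, h5⟩
      exact ⟨⟨h1, h2⟩, (hb h1).2 ⟨h4, h5⟩⟩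

variable {Ω E : Type*} [MeasurableSpace Ω] {μ : Measure Ω}
  [MeasurableSpace E] [MeasurableSingletonClass E] [Countable E]
  {a : ℕ → Ω → ℕ} {V : ℕ → Ω → E} {pa : ℕ → ℝ≥0∞} {pv : E → ℝ≥0∞}

/-- Blocks of random i.i.d. lengths of an independent i.i.d. sequence are i.i.d. -/
theorem isIIDWithLaw_blocks (ha : IsIIDWithLaw μ a pa) (hV : IsIIDWithLaw μ V pv)
    (hind : IndepFun (fun ω n => a n ω) (fun ω i => V i ω) μ) :
    IsIIDWithLaw μ (blocks a V) (fun l => pa l.length * (l.map pv).prod) where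
  measurableSet_eq n l := by
    have : {ω | blocks a V n ω = l} = ⋃ hs ∈ {hs : List (List E) | hs.length = n},
        {ω | history (blocks a V) (n + 1) ω = hs ++ [l]} := by
      ext ω
      simp only [history_succ, List.append_singleton_inj, Set.mem_iUnion, Set.mem_ofPred_eq]
      exact ⟨fun h => ⟨_, length_history _ n ω, rfl, h⟩, fun ⟨_, _, _, h⟩ => h⟩
    rw [this]
    refine MeasurableSet.biUnion (Set.to_countable _) fun hs hhs => ?_
    have hn : n + 1 = (hs ++ [l]).length := by simp [show hs.length = n from hhs]
    simp only [hn, history_blocks_eq_iff]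
    exact (measurableSet_history_eq ha.measurableSet_eq _ _).inter
      (measurableSet_history_eq hV.measurableSet_eq _ _)
  history_eq hs := by
    have h1 : MeasurableSet {s : ℕ → ℕ | history (fun n s => s n) hs.length s =
        hs.map List.length} :=
      measurableSet_history_eq (fun n y => measurable_pi_apply n (measurableSet_singleton y)) _ _
    have h2 : MeasurableSet {s : ℕ → E | history (fun n s => s n) hs.flatten.length s =
        hs.flatten} :=
      measurableSet_history_eq (fun n y => measurable_pi_apply n (measurableSet_singleton y)) _ _
    simp only [history_blocks_eq_iff]
    have h3 := hind.measure_inter_preimage_eq_mul _ _ h1 h2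
    have h4 := ha.history_eq (hs.map List.length)
    rw [List.length_map] at h4
    refine h3.trans ?_
    refine (congrArg₂ (· * ·) h4 (hV.history_eq hs.flatten)).trans ?_
    rw [List.prod_map_mul, List.map_map, List.map_flatten, List.prod_flatten, List.map_map]
    rfl

/-- Wald's identity. -/
theorem lintegral_sum_block (ha : ∀ n, Measurable (a n)) (hVm : ∀ n, Measurable (V n))
    (hV : ∀ n, IdentDistrib (V n) (V 0) μ μ)
    (hind : IndepFun (fun ω n => a n ω) (fun ω i => V i ω) μ) (φ : E → ℝ≥0∞) :
    ∫⁻ ω, ((blocks a V 0 ω).map φ).sum ∂μ =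
      (∫⁻ ω, (a 0 ω : ℝ≥0∞) ∂μ) * ∫⁻ ω, φ (V 0 ω) ∂μ := by
  have hφ : Measurable φ := measurable_of_countable φ
  have hlt : ∀ j, Measurable fun n : ℕ => if j < n then (1 : ℝ≥0∞) else 0 :=
    fun j => measurable_of_countable _
  have hcard : ∀ n : ℕ, (n : ℝ≥0∞) = ∑' j, if j < n then 1 else 0 := fun n => by
    rw [tsum_eq_sum (s := Finset.range n) (by simp)]
    rw [Finset.sum_congr rfl (g := fun _ => 1) fun j hj => if_pos (Finset.mem_range.1 hj)]
    simp
  -- Block `0` starts at index `0`, and `{j < a 0}` is independent of `V j`, so the expectation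
  -- factorizes term by term.
  have hsum : ∀ ω, ((blocks a V 0 ω).map φ).sum =
      ∑' j, (if j < a 0 ω then 1 else 0) * φ (V j ω) := fun ω => by
    rw [tsum_eq_sum (s := Finset.range (a 0 ω)) fun j hj => by
      rw [if_neg (by simpa using hj), zero_mul]]
    rw [Finset.sum_congr rfl (g := fun j => φ (V j ω))
      fun j hj => by rw [if_pos (Finset.mem_range.1 hj), one_mul]]
    rw [Finset.sum_range, ← List.sum_ofFn]
    congr 1
    exact List.ext_getElem (by simp [blocks]) fun i h1 h2 => by simp [blocks]
  simp only [hsum]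
  rw [lintegral_tsum (f := fun j ω => (if j < a 0 ω then 1 else 0) * φ (V j ω))
    fun j => (((hlt j).comp (ha 0)).mul (hφ.comp (hVm j))).aemeasurable]
  have hterm : ∀ j, ∫⁻ ω, (if j < a 0 ω then 1 else 0) * φ (V j ω) ∂μ =
      (∫⁻ ω, (if j < a 0 ω then 1 else 0) ∂μ) * ∫⁻ ω, φ (V 0 ω) ∂μ := fun j => by
    have hi : IndepFun (fun ω => if j < a 0 ω then (1 : ℝ≥0∞) else 0) (fun ω => φ (V j ω)) μ :=
      hind.comp (φ := fun s : ℕ → ℕ => if j < s 0 then (1 : ℝ≥0∞) else 0)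
        (ψ := fun s : ℕ → E => φ (s j)) ((hlt j).comp (measurable_pi_apply 0))
        (hφ.comp (measurable_pi_apply j))
    have h1 := lintegral_mul_eq_lintegral_mul_lintegral_of_indepFun
      ((hlt j).comp (ha 0)) (hφ.comp (hVm j)) hi
    refine h1.trans ?_
    congr 1
    exact ((hV j).comp hφ).lintegral_eq
  simp only [hterm]
  rw [ENNReal.tsum_mul_right, ← lintegral_tsum (f := fun j ω => if j < a 0 ω then 1 else 0)
    fun j => ((hlt j).comp (ha 0)).aemeasurable]
  simp only [hcard]

end Blocks

/-! ### The Lyapunov function and its drift without arrivals. -/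

section Deterministic

variable {F : Type*}

instance [Countable F] : Countable (Request F) :=
  Function.Injective.countable (f := fun q : Request F => (q.prefill, q.decode, q.feature))
    fun q r h => by
      simp only [Prod.mk.injEq] at h
      exact Request.ext h.1 h.2.1 h.2.2

theorem sum_map_eq_sum_get {E M : Type*} [AddCommMonoid M] (l : List E) (φ : E → M) :
    (l.map φ).sum = ∑ i, φ (l.get i) := by
  conv_lhs => rw [← List.ofFn_get l]
  rw [List.map_ofFn, List.sum_ofFn]
  rfl

/-- A request after the load `d` has been taken from it. -/
def Request.afterLoad (q : Request F) (d : Load) : Request F where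
  prefill := q.prefill - d.prefill
  decode := q.decode - d.decode
  feature := q.feature

theorem sum_map_loadedQueue_le (π : Policy F) (x : State F) (φ : Request F → ℕ) :
    ((loadedQueue π x).map φ).sum ≤ ∑ i, φ ((x.queue.get i).afterLoad (π x i)) := by
  refine ((List.filter_sublist.map φ).sum_le_sum (by simp)).trans_eq ?_
  rw [List.map_ofFn, List.sum_ofFn]
  rfl

theorem sum_map_loadedQueue_eq (π : Policy F) (x : State F) (φ : Request F → ℕ)
    (h : ∀ i, ((x.queue.get i).afterLoad (π x i)).decode = 0 →
      φ ((x.queue.get i).afterLoad (π x i)) = 0) :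
    ((loadedQueue π x).map φ).sum = ∑ i, φ ((x.queue.get i).afterLoad (π x i)) := by
  have key : ∀ l : List (Request F), (∀ q ∈ l, q.decode = 0 → φ q = 0) →
      ((l.filter fun q => q.decode ≠ 0).map φ).sum = (l.map φ).sum := by
    intro l hl
    induction l with
    | nil => simp
    | cons q l ih =>
      have ih' := ih fun r hr => hl r (List.mem_cons_of_mem _ hr)
      by_cases hq : q.decode = 0
      · simpa [List.filter_cons, hq, hl q List.mem_cons_self hq] using ih'
      · simpa [List.filter_cons, hq] using ih'
  refine (key _ fun q hq => ?_).trans ?_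
  · obtain ⟨i, rfl⟩ := (List.mem_ofFn' _ _).1 hq
    exact h i
  · rw [List.map_ofFn, List.sum_ofFn]
    rfl

/-- The load of each request is feasible. -/
def IsFeasible (π : Policy F) (x : State F) : Prop :=
  ∀ i : Fin x.queue.length,
    (0 < (x.queue.get i).prefill → (π x i).decode = 0) ∧
    (π x i).prefill ≤ (x.queue.get i).prefill ∧ (π x i).decode ≤ 1

theorem State.Valid.step {t : ℕ → ℕ} {π : Policy F} {x : State F} (hx : x.Valid)
    {new : List (Request F)} (hnew : ∀ q ∈ new, 1 ≤ q.decode) : (step t π x new).Valid := by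
  intro q hq
  unfold LLMEngine.step at hq
  split_ifs at hq with h
  · rcases List.mem_append.1 hq with hq | hq
    · have := (List.mem_filter.1 hq).2
      simp only [ne_eq, decide_not, Bool.not_eq_eq_eq_not, Bool.not_true,
        decide_eq_false_iff_not] at this
      omega
    · exact hnew q hq
  · rcases List.mem_append.1 hq with hq | hq
    · exact hx q hq
    · exact hnew q hq

/-- The contribution of a request to the Lyapunov function: its work, and the square of an upper
bound of the number of batches that it still needs when no token is held back. -/
def Request.weight (h : ℕ) (q : Request F) : ℕ :=
  h * (q.prefill + q.decode) + (q.decode + if q.prefill = 0 then 0 else 1) ^ 2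

/-- The Lyapunov function of the scheduling chain. -/
def State.lyapunov (h κ : ℕ) (x : State F) : ℕ :=
  (x.queue.map (Request.weight h)).sum + κ * x.remaining

theorem Request.weight_afterLoad (h : ℕ) (q : Request F) (d : Load) :
    (q.afterLoad d).weight h = h * (q.prefill - d.prefill + (q.decode - d.decode)) +
      (q.decode - d.decode + if q.prefill - d.prefill = 0 then 0 else 1) ^ 2 := rfl

theorem Request.weight_afterLoad_add_le (h : ℕ) {q : Request F} (hq : 1 ≤ q.decode) {d : Load}
    (hp : d.prefill ≤ q.prefill) (hd : d.decode ≤ 1) :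
    (q.afterLoad d).weight h + h * (d.decode + d.prefill) ≤ q.weight h := by
  have h1 : h * (q.prefill - d.prefill + (q.decode - d.decode)) + h * (d.decode + d.prefill) =
      h * (q.prefill + q.decode) := by
    rw [← mul_add]
    congr 1
    omega
  have h2 : (q.decode - d.decode + if q.prefill - d.prefill = 0 then 0 else 1) ≤
      q.decode + if q.prefill = 0 then 0 else 1 := by
    split_ifs <;> omega
  have h3 := Nat.pow_le_pow_left h2 2
  rw [weight_afterLoad, weight]
  omega

theorem Request.weight_afterLoad_add_decode_le (h : ℕ) {q : Request F} (hq : 1 ≤ q.decode)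
    {d : Load} (hp : d.prefill = q.prefill) (hd : d.decode = if q.prefill = 0 then 1 else 0) :
    (q.afterLoad d).weight h + q.decode ≤ q.weight h := by
  have h1 : h * (q.prefill - d.prefill + (q.decode - d.decode)) ≤ h * (q.prefill + q.decode) :=
    Nat.mul_le_mul_left _ (by omega)
  rw [weight_afterLoad, weight]
  have h2 : (q.decode - d.decode + if q.prefill - d.prefill = 0 then 0 else 1) ^ 2 + q.decode ≤
      (q.decode + if q.prefill = 0 then 0 else 1) ^ 2 := by
    rw [hp, hd]
    obtain ⟨D, hD⟩ : ∃ D, q.decode = D + 1 := ⟨q.decode - 1, by omega⟩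
    rw [hD]
    split_ifs
    · simp
      nlinarith
    · omega
    · simp
      nlinarith
    · omega
  omega

/-- Each loaded token lowers the linear part by `h`, and loading never increases the squares. This
is the estimate for full batches. -/
theorem IsFeasible.lyapunov_step_le {π : Policy F} {x : State F} (hπ : IsFeasible π x)
    (hx : x.Valid) (hR : x.remaining = 0) (t : ℕ → ℕ) (ht : 1 ≤ t (tokenLoad π x)) (h κ : ℕ) :
    (step t π x []).lyapunov h κ + κ + h * tokenLoad π x ≤
      x.lyapunov h κ + κ * t (tokenLoad π x) := by
  have h1 : ∑ i, ((x.queue.get i).afterLoad (π x i)).weight h + h * tokenLoad π x ≤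
      (x.queue.map (Request.weight h)).sum := by
    rw [sum_map_eq_sum_get, tokenLoad, Finset.mul_sum, ← Finset.sum_add_distrib]
    exact Finset.sum_le_sum fun i _ => Request.weight_afterLoad_add_le h
      (hx _ (List.get_mem _ _)) (hπ i).2.1 (hπ i).2.2
  have h2 := sum_map_loadedQueue_le π x (Request.weight h)
  obtain ⟨s, hs⟩ : ∃ s, t (tokenLoad π x) = s + 1 := ⟨t (tokenLoad π x) - 1, by omega⟩
  simp only [State.lyapunov, step, hR, if_true, hs, List.append_nil, mul_add, mul_zero, mul_one,
    Nat.add_sub_cancel]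
  omega

theorem IsFeasible.eq_of_tokenLoad_eq_available {π : Policy F} {x : State F}
    (hπ : IsFeasible π x) (h : tokenLoad π x = x.available) (i : Fin x.queue.length) :
    (π x i).prefill = (x.queue.get i).prefill ∧
      (π x i).decode = if (x.queue.get i).prefill = 0 then 1 else 0 := by
  rw [State.available, sum_map_eq_sum_get, tokenLoad] at h
  have hle : ∀ j : Fin x.queue.length, (π x j).decode + (π x j).prefill ≤
      (x.queue.get j).prefill + if (x.queue.get j).prefill = 0 then 1 else 0 := by
    intro j
    have := hπ j
    split_ifs <;> omega
  have heq := (Finset.sum_eq_sum_iff_of_le fun j _ => hle j).1 h i (Finset.mem_univ i)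
  have := hπ i
  split_ifs at heq ⊢ <;> omega

/-- When everything available is loaded, each request completes its prefill or decodes one token, so
its `N` drops by one and `N ^ 2 - (N - 1) ^ 2 = 2 N - 1 ≥ D`. -/
theorem IsFeasible.lyapunov_step_add_decode_le {π : Policy F} {x : State F}
    (hπ : IsFeasible π x) (hx : x.Valid) (hR : x.remaining = 0) (t : ℕ → ℕ)
    (ht : 1 ≤ t (tokenLoad π x)) (hload : tokenLoad π x = x.available) (h κ : ℕ) :
    (step t π x []).lyapunov h κ + κ + (x.queue.map Request.decode).sum ≤
      x.lyapunov h κ + κ * t (tokenLoad π x) := by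
  have h1 : ∑ i, ((x.queue.get i).afterLoad (π x i)).weight h + (x.queue.map Request.decode).sum ≤
      (x.queue.map (Request.weight h)).sum := by
    rw [sum_map_eq_sum_get, sum_map_eq_sum_get, ← Finset.sum_add_distrib]
    refine Finset.sum_le_sum fun i _ => ?_
    obtain ⟨hp, hd⟩ := hπ.eq_of_tokenLoad_eq_available hload i
    exact Request.weight_afterLoad_add_decode_le h (hx _ (List.get_mem _ _)) hp hd
  have h2 := sum_map_loadedQueue_le π x (Request.weight h)
  obtain ⟨s, hs⟩ : ∃ s, t (tokenLoad π x) = s + 1 := ⟨t (tokenLoad π x) - 1, by omega⟩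
  simp only [State.lyapunov, step, hR, if_true, hs, List.append_nil, mul_add, mul_zero, mul_one,
    Nat.add_sub_cancel]
  omega

theorem lyapunov_step (t : ℕ → ℕ) (π : Policy F) (x : State F) (new : List (Request F))
    (h κ : ℕ) : (step t π x new).lyapunov h κ =
      (step t π x []).lyapunov h κ + (new.map (Request.weight h)).sum := by
  unfold State.lyapunov step
  split_ifs <;> simp only [List.map_append, List.sum_append, List.map_nil, List.sum_nil] <;> ring

theorem lyapunov_step_of_remaining_ne_zero (t : ℕ → ℕ) (π : Policy F) {x : State F}
    (hR : x.remaining ≠ 0) (h κ : ℕ) :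
    (step t π x []).lyapunov h κ + κ = x.lyapunov h κ := by
  obtain ⟨r, hr⟩ : ∃ r, x.remaining = r + 1 := ⟨x.remaining - 1, by omega⟩
  simp only [State.lyapunov, step, hr, List.append_nil]
  simp [mul_add, add_assoc]

/-- The drift of the Lyapunov function, arrivals excluded, under a work-conserving algorithm. -/
theorem lyapunov_drift {b : ℕ} {t : ℕ → ℕ} {T : ℕ} (ht : ∀ k ≤ b, 1 ≤ t k ∧ t k ≤ T) {h κ : ℕ}
    (hκ : κ * t b ≤ h * b) {π : Policy F} {x : State F} (hx : x.Valid)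
    (hπ : x.remaining = 0 → IsFeasible π x)
    (hwc : x.remaining = 0 → tokenLoad π x = min b x.available) :
    (step t π x []).lyapunov h κ + κ ≤ x.lyapunov h κ + κ * T ∧
      (¬ (x.Valid ∧ x.remaining = 0 ∧ x.size ≤ κ * T + b) →
        (step t π x []).lyapunov h κ + κ ≤ x.lyapunov h κ) := by
  by_cases hR : x.remaining = 0
  · have hle : tokenLoad π x ≤ b := by rw [hwc hR]; exact min_le_left _ _
    have hT : κ * t (tokenLoad π x) ≤ κ * T := Nat.mul_le_mul_left _ (ht _ hle).2
    have h1 := (hπ hR).lyapunov_step_le hx hR t (ht _ hle).1 h κ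
    refine ⟨by omega, fun hsize => ?_⟩
    rcases le_or_gt b x.available with hb | hb
    · have hfull : tokenLoad π x = b := by rw [hwc hR, min_eq_left hb]
      rw [hfull] at h1
      omega
    · have hload : tokenLoad π x = x.available := by rw [hwc hR, min_eq_right hb.le]
      have h2 := (hπ hR).lyapunov_step_add_decode_le hx hR t (ht _ hle).1 hload h κ
      -- Together with `x.available < b` and `x.size > κ * T + b`, this leaves more than `κ * T`
      -- decode tokens, enough to pay for the processing time of the batch.
      have h3 : x.size ≤ x.available + (x.queue.map Request.decode).sum := by
        rw [State.size, State.available, sum_map_eq_sum_get, sum_map_eq_sum_get,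
          sum_map_eq_sum_get, ← Finset.sum_add_distrib]
        exact Finset.sum_le_sum fun i _ => by omega
      have h4 : κ * T + b < x.size := by
        by_contra! hcon
        exact hsize ⟨hx, hR, hcon⟩
      omega
  · have := lyapunov_step_of_remaining_ne_zero t π hR h κ
    exact ⟨by omega, fun _ => by omega⟩

/-- Validity gives each request a decode token, so the size bounds the queue length as well as the
token counts. -/
theorem finite_valid_size_le [Finite F] (M : ℕ) :
    {x : State F | x.Valid ∧ x.remaining = 0 ∧ x.size ≤ M}.Finite := by
  let toRequest : Fin (M + 1) × Fin (M + 1) × F → Request F := fun p => ⟨p.1, p.2.1, p.2.2⟩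
  let toState : List (Fin (M + 1) × Fin (M + 1) × F) → State F := fun l => ⟨0, l.map toRequest⟩
  refine ((List.finite_length_le (Fin (M + 1) × Fin (M + 1) × F) M).image toState).subset ?_
  rintro ⟨r, Q⟩ ⟨hv, hr, hs⟩
  simp only [State.size, State.Valid] at hv hr hs
  have hmem : ∀ q ∈ Q, q.prefill + q.decode ≤ M := fun q hq =>
    (List.single_le_sum (by simp) _ (List.mem_map_of_mem hq)).trans hs
  have hlen : Q.length ≤ M := by
    refine le_trans ?_ hs
    have : (Q.map fun _ => 1).sum ≤ (Q.map fun q => q.prefill + q.decode).sum :=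
      List.sum_le_sum fun q hq => by have := hv q hq; omega
    simpa using this
  refine ⟨Q.attach.map fun q => (⟨q.1.prefill, ?_⟩, ⟨q.1.decode, ?_⟩, q.1.feature), ?_, ?_⟩
  · have := hmem q.1 q.2
    omega
  · have := hmem q.1 q.2
    omega
  · simpa using hlen
  · simp only [toState, State.mk.injEq, hr, true_and, List.map_map]
    exact List.attach_map_subtype_val Q

end Deterministic

/-! ### Overload: a pathwise lower bound and the strong law. -/

section Transience

variable {Ω F : Type*} {t : ℕ → ℕ} {π : Policy F} {b : ℕ}

/-- Removing a request loses no tokens: its last decode token can be loaded only when no prefill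
tokens are left. -/
theorem IsFeasible.size_loadedQueue {x : State F} (hπ : IsFeasible π x) (hx : x.Valid) :
    ((loadedQueue π x).map fun q => q.prefill + q.decode).sum + tokenLoad π x = x.size := by
  rw [sum_map_loadedQueue_eq π x, State.size, sum_map_eq_sum_get, tokenLoad,
    ← Finset.sum_add_distrib]
  · refine Finset.sum_congr rfl fun i _ => ?_
    have h1 := hπ i
    have h2 := hx _ (List.get_mem x.queue i)
    simp only [Request.afterLoad]
    omega
  · intro i hi
    have h1 := hπ i
    have h2 := hx _ (List.get_mem x.queue i)
    simp only [Request.afterLoad] at hi ⊢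
    omega

/-- No batch works faster than the rate `ρ`. -/
theorem size_step_ge {ρ : ℝ} (ht : ∀ k ≤ b, 1 ≤ t k) (hρ : ∀ k ≤ b, (k : ℝ) ≤ ρ * t k)
    {x : State F} (hx : x.Valid) (hπ : x.remaining = 0 → IsFeasible π x ∧ tokenLoad π x ≤ b)
    (new : List (Request F)) :
    (x.size : ℝ) + ρ * x.remaining + ((new.map fun q => q.prefill + q.decode).sum : ℕ) ≤
      (step t π x new).size + ρ * ((step t π x new).remaining + 1) := by
  by_cases hR : x.remaining = 0
  · obtain ⟨h1, h2⟩ := hπ hR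
    have h3 := h1.size_loadedQueue hx
    -- A batch of `k` tokens lowers the size by `k`, while `ρ R` gains `ρ (t k - 1)` and the slot
    -- itself counts `ρ`.
    have h4 := hρ _ h2
    obtain ⟨s, hs⟩ : ∃ s, t (tokenLoad π x) = s + 1 :=
      ⟨t (tokenLoad π x) - 1, by have := ht _ h2; omega⟩
    have hsize : (step t π x new).size =
        ((loadedQueue π x).map fun q => q.prefill + q.decode).sum +
          (new.map fun q => q.prefill + q.decode).sum := by
      simp [step, hR, State.size]
    have hrem : (step t π x new).remaining = s := by simp [step, hR, hs]
    rw [← h3, hsize, hrem, hR, Nat.cast_add, Nat.cast_add, Nat.cast_zero]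
    rw [hs, Nat.cast_add, Nat.cast_one] at h4
    linarith
  · obtain ⟨r, hr⟩ : ∃ r, x.remaining = r + 1 := ⟨x.remaining - 1, by omega⟩
    have hsize : (step t π x new).size =
        x.size + (new.map fun q => q.prefill + q.decode).sum := by
      simp [step, hR, State.size]
    have hrem : (step t π x new).remaining = r := by simp [step, hr]
    rw [hsize, hrem, hr, Nat.cast_add, Nat.cast_add, Nat.cast_one]
    linarith

theorem remaining_step_le {T : ℕ} (ht : ∀ k ≤ b, t k ≤ T) {x : State F} {R : ℕ}
    (hx : x.remaining ≤ R) (hTR : T ≤ R) (hπ : x.remaining = 0 → tokenLoad π x ≤ b)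
    (new : List (Request F)) : (step t π x new).remaining ≤ R := by
  by_cases hR : x.remaining = 0
  · have := ht _ (hπ hR)
    simp only [step, hR, if_true]
    omega
  · simp only [step, hR, if_false]
    omega

theorem valid_chain {a vp vd : ℕ → Ω → ℕ} {z : ℕ → Ω → F} (hvd : ∀ i ω, 1 ≤ vd i ω)
    {x : State F} (hx : x.Valid) (n : ℕ) (ω : Ω) : (chain t π a vp vd z x n ω).Valid := by
  induction n with
  | zero => exact hx
  | succ n ih =>
    refine ih.step fun q hq => ?_
    obtain ⟨j, -, rfl⟩ := List.mem_map.1 hq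
    exact hvd _ ω

theorem sum_size_arrivals (a vp vd : ℕ → Ω → ℕ) (z : ℕ → Ω → F) (n : ℕ) (ω : Ω) :
    ∑ k ∈ Finset.range n, ((arrivals a vp vd z k ω).map fun q => q.prefill + q.decode).sum =
      ∑ i ∈ Finset.range (∑ k ∈ Finset.range n, a k ω), (vp i ω + vd i ω) := by
  induction n with
  | zero => simp
  | succ n ih =>
    rw [Finset.sum_range_succ, ih, Finset.sum_range_succ _ n, Finset.sum_range_add]
    congr 1
    rw [Finset.sum_range, ← List.sum_ofFn]
    congr 1
    exact List.ext_getElem (by simp [arrivals]) fun i h1 h2 => by simp [arrivals]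

/-- A pathwise lower bound of the number of unprocessed tokens. -/
theorem size_chain_ge {a vp vd : ℕ → Ω → ℕ} {z : ℕ → Ω → F} (hvd : ∀ i ω, 1 ≤ vd i ω)
    {ρ : ℝ} (hρ0 : 0 ≤ ρ) {T : ℕ} (ht : ∀ k ≤ b, 1 ≤ t k ∧ t k ≤ T)
    (hρ : ∀ k ≤ b, (k : ℝ) ≤ ρ * t k) {x : State F} (hx : x.Valid) {ω : Ω}
    (hπ : ∀ n, (chain t π a vp vd z x n ω).remaining = 0 →
      IsFeasible π (chain t π a vp vd z x n ω) ∧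
        tokenLoad π (chain t π a vp vd z x n ω) ≤ b) (n : ℕ) :
    (∑ i ∈ Finset.range (∑ k ∈ Finset.range n, a k ω), ((vp i ω : ℝ) + vd i ω)) - ρ * n -
      ρ * (x.remaining + T : ℕ) ≤ (chain t π a vp vd z x n ω).size := by
  have h1 : (chain t π a vp vd z x n ω).remaining ≤ x.remaining + T := by
    induction n with
    | zero => exact Nat.le_add_right _ _
    | succ n ih =>
      exact remaining_step_le (fun k hk => (ht k hk).2) ih (Nat.le_add_left _ _)
        (fun h => (hπ n h).2) _
  have h2 : ((∑ k ∈ Finset.range n,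
      ((arrivals a vp vd z k ω).map fun q => q.prefill + q.decode).sum : ℕ) : ℝ) ≤
      (chain t π a vp vd z x n ω).size +
        ρ * ((chain t π a vp vd z x n ω).remaining + n) := by
    clear h1
    induction n with
    | zero =>
      rw [Finset.range_zero, Finset.sum_empty, Nat.cast_zero]
      positivity
    | succ n ih =>
      have h3 := size_step_ge (fun k hk => (ht k hk).1) hρ (valid_chain hvd hx n ω) (hπ n)
        (arrivals a vp vd z n ω)
      rw [Finset.sum_range_succ, Nat.cast_add, Nat.cast_add, Nat.cast_one]
      simp only [chain]
      linarith
  rw [sum_size_arrivals] at h2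
  have h3 : ρ * ((chain t π a vp vd z x n ω).remaining : ℝ) ≤ ρ * (x.remaining + T : ℕ) := by
    gcongr
  push_cast at h2 h3 ⊢
  linarith

/-- A sum of `A n` terms grows faster than `ρ n` if the rate of `A` times the mean of the terms
exceeds `ρ`. -/
theorem tendsto_sum_range_sub_atTop {A : ℕ → ℕ} {w : ℕ → ℝ} {lam m ρ c : ℝ}
    (hA : Tendsto (fun n => (A n : ℝ) / n) atTop (nhds lam))
    (hw : Tendsto (fun n : ℕ => (∑ i ∈ Finset.range n, w i) / n) atTop (nhds m))
    (hlam : 0 < lam) (hρ : ρ < lam * m) :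
    Tendsto (fun n : ℕ => (∑ i ∈ Finset.range (A n), w i) - ρ * n - c) atTop atTop := by
  have hAtop : Tendsto A atTop atTop := by
    rw [← tendsto_natCast_atTop_iff (R := ℝ)]
    refine (hA.pos_mul_atTop hlam tendsto_natCast_atTop_atTop).congr' ?_
    filter_upwards [eventually_gt_atTop 0] with n hn
    have : (n : ℝ) ≠ 0 := by positivity
    field_simp
  have h1 : Tendsto (fun n => (A n : ℝ) / n * ((∑ i ∈ Finset.range (A n), w i) / A n) - ρ)
      atTop (nhds (lam * m - ρ)) := (hA.mul (hw.comp hAtop)).sub_const ρ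
  have h2 := tendsto_atTop_add_const_right atTop (-c)
    (h1.pos_mul_atTop (sub_pos.2 hρ) tendsto_natCast_atTop_atTop)
  refine h2.congr' ?_
  filter_upwards [eventually_gt_atTop 0, hAtop.eventually_gt_atTop 0] with n hn hAn
  have h3 : (n : ℝ) ≠ 0 := by positivity
  have h4 : (A n : ℝ) ≠ 0 := by positivity
  field_simp
  ring

instance [Countable F] : Countable (State F) :=
  Function.Injective.countable (f := fun x : State F => (x.remaining, x.queue))
    fun x y h => by
      simp only [Prod.mk.injEq] at h
      exact State.ext h.1 h.2

/-- There are countably many states, so those of probability zero can be discarded together. Almost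
every path then meets only states at which the algorithm is constrained. -/
theorem ae_mem_stateSpace [MeasurableSpace Ω] (μ : Measure Ω) [Countable F]
    (X : State F → ℕ → Ω → State F) (x₀ : State F) :
    ∀ᵐ ω ∂μ, ∀ n, X x₀ n ω ∈ stateSpace μ X x₀ := by
  rw [ae_all_iff]
  intro n
  have h : ∀ᵐ ω ∂μ, ∀ y, y ∉ stateSpace μ X x₀ → X x₀ n ω ≠ y := by
    rw [ae_all_iff]
    intro y
    by_cases hy : y ∈ stateSpace μ X x₀
    · simp [hy]
    · have h0 : μ {ω | X x₀ n ω = y} = 0 := by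
        by_contra h0
        exact hy ⟨n, pos_iff_ne_zero.2 h0⟩
      filter_upwards [measure_eq_zero_iff_ae_notMem.1 h0] with ω hω _ using hω
  filter_upwards [h] with ω hω
  by_contra hn
  exact hω _ hn rfl

theorem ae_tendsto_size_atTop [MeasurableSpace Ω] {μ : Measure Ω} [IsProbabilityMeasure μ]
    [Countable F] (hb : 1 ≤ b) (ht : ∀ k ≤ b, 1 ≤ t k) {a vp vd : ℕ → Ω → ℕ} {z : ℕ → Ω → F}
    (hvd_pos : ∀ i ω, 1 ≤ vd i ω)
    (ha_indep : iIndepFun a μ) (ha_ident : ∀ n, IdentDistrib (a n) (a 0) μ μ)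
    (hv_indep : iIndepFun (fun i ω => (vp i ω, vd i ω)) μ)
    (hv_ident : ∀ i, IdentDistrib (fun ω => (vp i ω, vd i ω)) (fun ω => (vp 0 ω, vd 0 ω)) μ μ)
    (ha_int : Integrable (fun ω => (a 0 ω : ℝ)) μ)
    (hvp_int : Integrable (fun ω => (vp 0 ω : ℝ)) μ)
    (hvd_int : Integrable (fun ω => (vd 0 ω : ℝ)) μ)
    (hload : (∫ ω, (a 0 ω : ℝ) ∂μ) * (∫ ω, (vp 0 ω : ℝ) ∂μ + ∫ ω, (vd 0 ω : ℝ) ∂μ) >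
      (b : ℝ) / t b)
    (hmax : ∀ k ≤ b, (k : ℝ) / t k ≤ (b : ℝ) / t b) {x₀ : State F} (hx₀ : x₀.Valid)
    (hπ : IsSchedulingAlgorithm b π (stateSpace μ (chain t π a vp vd z) x₀)) :
    ∀ᵐ ω ∂μ, Tendsto (fun n => (chain t π a vp vd z x₀ n ω).size) atTop atTop := by
  have hρ0 : (0 : ℝ) ≤ (b : ℝ) / t b := by positivity
  have hρ : ∀ k ≤ b, (k : ℝ) ≤ (b : ℝ) / t b * t k := fun k hk => by
    have h1 : (0 : ℝ) < t k := by exact_mod_cast ht k hk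
    exact (div_le_iff₀ h1).1 (hmax k hk)
  have hT : ∀ k ≤ b, 1 ≤ t k ∧ t k ≤ (Finset.range (b + 1)).sup t := fun k hk =>
    ⟨ht k hk, Finset.le_sup (Finset.mem_range.2 (by omega))⟩
  have ha_nonneg : 0 ≤ ∫ ω, (a 0 ω : ℝ) ∂μ := integral_nonneg fun ω => by positivity
  -- A positive arrival rate makes the number of arrivals tend to infinity, so the strong law for
  -- request sizes can be evaluated along it.
  have ha_pos : 0 < ∫ ω, (a 0 ω : ℝ) ∂μ := by
    refine lt_of_le_of_ne ha_nonneg fun h => ?_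
    rw [← h, zero_mul] at hload
    linarith
  have hcast : Measurable fun n : ℕ => (n : ℝ) := measurable_of_countable _
  have hadd : Measurable fun p : ℕ × ℕ => (p.1 : ℝ) + p.2 := measurable_of_countable _
  have hA := strong_law_ae_real (fun n ω => (a n ω : ℝ)) ha_int
    (fun i j hij => (ha_indep.indepFun hij).comp hcast hcast) fun n => (ha_ident n).comp hcast
  have hW := strong_law_ae_real (fun n ω => (vp n ω : ℝ) + vd n ω) (hvp_int.add hvd_int)
    (fun i j hij => (hv_indep.indepFun hij).comp hadd hadd) fun n => (hv_ident n).comp hadd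
  rw [integral_add hvp_int hvd_int] at hW
  filter_upwards [hA, hW, ae_mem_stateSpace μ (chain t π a vp vd z) x₀] with ω hAω hWω hmem
  rw [← tendsto_natCast_atTop_iff (R := ℝ)]
  refine tendsto_atTop_mono (size_chain_ge hvd_pos hρ0 hT hρ hx₀ fun n h0 => hπ _ (hmem n) h0) ?_
  refine tendsto_sum_range_sub_atTop (A := fun n => ∑ k ∈ Finset.range n, a k ω) ?_ hWω ha_pos hload
  simpa using hAω

end Transience

/-! ### Underload: choice of the constants and positive recurrence. -/

section Recurrence

variable {Ω F : Type*} [MeasurableSpace Ω] {μ : Measure Ω}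

instance : MeasurableSpace (Request F) := ⊤

theorem lintegral_natCast {u : Ω → ℕ} (hu : Integrable (fun ω => (u ω : ℝ)) μ) :
    ∫⁻ ω, (u ω : ℝ≥0∞) ∂μ = ENNReal.ofReal (∫ ω, (u ω : ℝ) ∂μ) := by
  rw [ofReal_integral_eq_lintegral_ofReal hu (ae_of_all _ fun ω => by positivity)]
  simp

theorem isPositiveRecurrentOn_of_isWorkConserving [IsProbabilityMeasure μ] [Finite F]
    [MeasurableSpace F] [MeasurableSingletonClass F] {b : ℕ} {t : ℕ → ℕ} (ht : ∀ k ≤ b, 1 ≤ t k)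
    {a vp vd : ℕ → Ω → ℕ} {z : ℕ → Ω → F}
    (ha_meas : ∀ n, Measurable (a n)) (hvp_meas : ∀ i, Measurable (vp i))
    (hvd_meas : ∀ i, Measurable (vd i)) (hz_meas : ∀ i, Measurable (z i))
    (hvp_pos : ∀ i ω, 1 ≤ vp i ω) (hvd_pos : ∀ i ω, 1 ≤ vd i ω)
    (ha_indep : iIndepFun a μ) (ha_ident : ∀ n, IdentDistrib (a n) (a 0) μ μ)
    (hv_indep : iIndepFun (fun i ω => (vp i ω, vd i ω, z i ω)) μ)
    (hv_ident : ∀ i, IdentDistrib (fun ω => (vp i ω, vd i ω, z i ω))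
      (fun ω => (vp 0 ω, vd 0 ω, z 0 ω)) μ μ)
    (hav_indep : IndepFun (fun ω n => a n ω) (fun ω i => (vp i ω, vd i ω, z i ω)) μ)
    (ha_int : Integrable (fun ω => (a 0 ω : ℝ)) μ)
    (hvp_int : Integrable (fun ω => (vp 0 ω : ℝ)) μ)
    (hvd_int : Integrable (fun ω => (vd 0 ω : ℝ)) μ)
    (hvd_sq : Integrable (fun ω => (vd 0 ω : ℝ) ^ 2) μ)
    (hload : (∫ ω, (a 0 ω : ℝ) ∂μ) * (∫ ω, (vp 0 ω : ℝ) ∂μ + ∫ ω, (vd 0 ω : ℝ) ∂μ) <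
      (b : ℝ) / t b)
    {π : Policy F} {x₀ : State F} (hx₀ : x₀.Valid)
    (hπ : IsSchedulingAlgorithm b π (stateSpace μ (chain t π a vp vd z) x₀))
    (hwc : IsWorkConserving b π (stateSpace μ (chain t π a vp vd z) x₀))
    (hirr : IsIrreducibleOn μ (chain t π a vp vd z) (stateSpace μ (chain t π a vp vd z) x₀)) :
    IsPositiveRecurrentOn μ (chain t π a vp vd z) (stateSpace μ (chain t π a vp vd z) x₀) := by
  have _ : MeasurableSingletonClass (Request F) := ⟨fun _ => trivial⟩
  set V : ℕ → Ω → Request F := fun i ω => ⟨vp i ω, vd i ω, z i ω⟩ with hV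
  set mk : ℕ × ℕ × F → Request F := fun p => ⟨p.1, p.2.1, p.2.2⟩ with hmk
  have hmk_meas : Measurable mk := measurable_of_countable mk
  have hV_meas : ∀ i, Measurable (V i) := fun i =>
    hmk_meas.comp ((hvp_meas i).prodMk ((hvd_meas i).prodMk (hz_meas i)))
  have hV_ident : ∀ i, IdentDistrib (V i) (V 0) μ μ := fun i => (hv_ident i).comp hmk_meas
  have hV_indep : iIndepFun V μ := hv_indep.comp (fun _ => mk) fun _ => hmk_meas
  have hind : IndepFun (fun ω n => a n ω) (fun ω i => V i ω) μ :=
    hav_indep.comp (φ := id) (ψ := fun (s : ℕ → ℕ × ℕ × F) i => mk (s i)) measurable_id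
      (measurable_pi_lambda _ fun i => hmk_meas.comp (measurable_pi_apply i))
  have hY := isIIDWithLaw_blocks (isIIDWithLaw_of_iIndepFun ha_meas ha_indep ha_ident)
    (isIIDWithLaw_of_iIndepFun hV_meas hV_indep hV_ident) hind
  set ν : List (Request F) → ℝ≥0∞ := fun l => μ {ω | a 0 ω = l.length} *
    (l.map fun y => μ {ω | V 0 ω = y}).prod
  set lam := ∫ ω, (a 0 ω : ℝ) ∂μ
  set m := ∫ ω, (vp 0 ω : ℝ) ∂μ + ∫ ω, (vd 0 ω : ℝ) ∂μ with hm
  set m₂ := ∫ ω, ((vd 0 ω : ℝ) + 1) ^ 2 ∂μ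
  have hlam : 0 ≤ lam := integral_nonneg fun ω => by positivity
  have hm0 : 0 ≤ m := add_nonneg (integral_nonneg fun ω => by positivity)
    (integral_nonneg fun ω => by positivity)
  have hm₂ : 0 ≤ m₂ := integral_nonneg fun ω => by positivity
  have htb : (0 : ℝ) < t b := by exact_mod_cast ht b le_rfl
  have hc : 0 < b - lam * m * t b := sub_pos.2 ((lt_div_iff₀ htb).1 hload)
  -- This is `(α + 2) * t b ≤ h * b` solved for `h`, with `α = lam * (h * m + m₂)`; the `2` covers
  -- the unit drift and the rounding of `α` to an integer.
  obtain ⟨h, hh⟩ := exists_nat_ge ((lam * m₂ + 2) * t b / (b - lam * m * t b))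
  rw [div_le_iff₀ hc] at hh
  set α : ℝ := lam * (h * m + m₂) with hα
  have hα0 : 0 ≤ α := by positivity
  set κ : ℕ := ⌈α⌉₊ + 1 with hκ
  have hκ1 : α + 1 ≤ κ := by rw [hκ]; push_cast; linarith [Nat.le_ceil α]
  have hκ2 : (κ : ℝ) ≤ α + 2 := by rw [hκ]; push_cast; linarith [Nat.ceil_lt_add_one hα0]
  have hκb : κ * t b ≤ h * b := by
    have : (κ : ℝ) * t b ≤ h * b := by
      refine (mul_le_mul_of_nonneg_right hκ2 htb.le).trans ?_
      rw [hα]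
      linarith
    exact_mod_cast this
  have hsq_int : Integrable (fun ω => ((vd 0 ω : ℝ) + 1) ^ 2) μ := by
    have : (fun ω => ((vd 0 ω : ℝ) + 1) ^ 2) =
        fun ω => (vd 0 ω : ℝ) ^ 2 + 2 * (vd 0 ω : ℝ) + 1 := by funext ω; ring
    rw [this]
    exact (hvd_sq.add (hvd_int.const_mul 2)).add (integrable_const 1)
  -- A new request has a prefill token, so its square is `(vd + 1) ^ 2`.
  have hweight : (fun ω => ((V 0 ω).weight h : ℝ)) =
      fun ω => h * ((vp 0 ω : ℝ) + vd 0 ω) + ((vd 0 ω : ℝ) + 1) ^ 2 := by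
    funext ω
    have := hvp_pos 0 ω
    simp [Request.weight, hV, show vp 0 ω ≠ 0 by omega]
  have hlin_int : Integrable (fun ω => (h : ℝ) * ((vp 0 ω : ℝ) + vd 0 ω)) μ :=
    (hvp_int.add hvd_int).const_mul _
  have harr : ∑' l, ν l * ((l.map (Request.weight h)).sum : ℕ) = ENNReal.ofReal α := by
    rw [← hY.lintegral_eq fun l => (((l.map (Request.weight h)).sum : ℕ) : ℝ≥0∞)]
    have h1 := lintegral_sum_block ha_meas hV_meas hV_ident hind
      fun q => ((q.weight h : ℕ) : ℝ≥0∞)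
    rw [lintegral_natCast ha_int, lintegral_natCast (by rw [hweight]; exact hlin_int.add hsq_int),
      hweight, integral_add hlin_int hsq_int, integral_const_mul, integral_add hvp_int hvd_int,
      ← ENNReal.ofReal_mul hlam] at h1
    rw [hα, hm, ← h1]
    refine lintegral_congr fun ω => ?_
    rw [← Nat.coe_castAddMonoidHom (α := ℝ≥0∞), map_list_sum, List.map_map]
    rfl
  -- The released `κ` absorbs the mean contribution `α` of the arrivals and the unit drift required
  -- by Foster's criterion.
  have hstep : ∀ x, ∑' l, ν l * ((step t π x l).lyapunov h κ : ℝ≥0∞) + 1 ≤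
      ((step t π x []).lyapunov h κ + κ : ℕ) := by
    intro x
    rw [tsum_congr fun l => by rw [lyapunov_step, Nat.cast_add, mul_add], Nat.cast_add]
    rw [ENNReal.tsum_add, harr, ENNReal.tsum_mul_right, hY.tsum_eq_one, one_mul, add_assoc]
    gcongr
    rw [← ENNReal.ofReal_one, ← ENNReal.ofReal_add hα0 zero_le_one, ← ENNReal.ofReal_natCast κ]
    exact ENNReal.ofReal_le_ofReal hκ1
  set T := (Finset.range (b + 1)).sup t
  have hT : ∀ k ≤ b, 1 ≤ t k ∧ t k ≤ T := fun k hk =>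
    ⟨ht k hk, Finset.le_sup (Finset.mem_range.2 (by omega))⟩
  have hvalid : ∀ x ∈ stateSpace μ (chain t π a vp vd z) x₀, x.Valid := by
    rintro x ⟨n, hn⟩
    obtain ⟨ω, rfl⟩ := nonempty_of_measure_ne_zero hn.ne'
    exact valid_chain hvd_pos hx₀ n ω
  have hdrift := fun x hx => lyapunov_drift hT hκb (hvalid x hx) (fun h0 => (hπ x hx h0).1)
    (hwc x hx)
  exact isPositiveRecurrent_of_drift (f := step t π) hY (X := chain t π a vp vd z)
    (fun _ _ => rfl) (fun _ _ _ => rfl) rfl hirr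
    (V := fun x => (x.lyapunov h κ : ℝ≥0∞)) (fun _ => ENNReal.natCast_ne_top _)
    (finite_valid_size_le (κ * T + b)) (K := (κ * T : ℕ)) (ENNReal.natCast_ne_top _)
    (fun x hx hxC => (hstep x).trans (by exact_mod_cast (hdrift x hx).2 hxC))
    (fun x hx => (hstep x).trans (by exact_mod_cast (hdrift x hx).1))

end Recurrence

end LLMEngine

theorem theorem1
    {Ω F : Type*} [MeasurableSpace Ω] (μ : Measure Ω) [IsProbabilityMeasure μ]
    [Finite F] [MeasurableSpace F] [MeasurableSingletonClass F]
    -- token budget and batch processing times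
    (b : ℕ) (hb : 1 ≤ b) (t : ℕ → ℕ) (ht : ∀ k ≤ b, 1 ≤ t k)
    -- numbers of arrivals; prefill tokens, decode tokens and features of the requests
    (a vp vd : ℕ → Ω → ℕ) (z : ℕ → Ω → F)
    (ha_meas : ∀ n, Measurable (a n)) (hvp_meas : ∀ i, Measurable (vp i))
    (hvd_meas : ∀ i, Measurable (vd i)) (hz_meas : ∀ i, Measurable (z i))
    (hvp_pos : ∀ i ω, 1 ≤ vp i ω) (hvd_pos : ∀ i ω, 1 ≤ vd i ω)
    -- two i.i.d. sequences that are independent of each other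
    (ha_indep : iIndepFun a μ) (ha_ident : ∀ n, IdentDistrib (a n) (a 0) μ μ)
    (hv_indep : iIndepFun (fun i ω => (vp i ω, vd i ω, z i ω)) μ)
    (hv_ident : ∀ i, IdentDistrib (fun ω => (vp i ω, vd i ω, z i ω))
      (fun ω => (vp 0 ω, vd 0 ω, z 0 ω)) μ μ)
    (hav_indep : IndepFun (fun ω n => a n ω) (fun ω i => (vp i ω, vd i ω, z i ω)) μ)
    -- moment assumptions
    (ha_int : Integrable (fun ω => (a 0 ω : ℝ)) μ)
    (hvp_int : Integrable (fun ω => (vp 0 ω : ℝ)) μ)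
    (hvd_int : Integrable (fun ω => (vd 0 ω : ℝ)) μ)
    (hvd_sq : Integrable (fun ω => (vd 0 ω : ℝ) ^ 2) μ)
    (lam mp md : ℝ) (hlam : lam = ∫ ω, (a 0 ω : ℝ) ∂μ)
    (hmp : mp = ∫ ω, (vp 0 ω : ℝ) ∂μ) (hmd : md = ∫ ω, (vd 0 ω : ℝ) ∂μ) :
    (lam * (mp + md) < (b : ℝ) / t b →
      ∀ (Kp Kd : ℕ), 1 ≤ Kp → 1 ≤ Kd →
      ∀ (π : LLMEngine.Policy F) (x₀ : LLMEngine.State F) (S : Set (LLMEngine.State F)),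
        x₀.Valid →
        S = LLMEngine.stateSpace μ (LLMEngine.chain t π a vp vd z) x₀ →
        LLMEngine.IsSchedulingAlgorithm b π S →
        LLMEngine.IsWorkConserving b π S →
        LLMEngine.IsFCFS Kp Kd π S →
        LLMEngine.IsIrreducibleOn μ (LLMEngine.chain t π a vp vd z) S →
        LLMEngine.IsPositiveRecurrentOn μ (LLMEngine.chain t π a vp vd z) S) ∧
    (lam * (mp + md) > (b : ℝ) / t b →
      -- the full batch has the largest token processing rate
      (∀ k ≤ b, (k : ℝ) / t k ≤ (b : ℝ) / t b) →
      ∀ (π : LLMEngine.Policy F) (x₀ : LLMEngine.State F),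
        x₀.Valid →
        LLMEngine.IsSchedulingAlgorithm b π
          (LLMEngine.stateSpace μ (LLMEngine.chain t π a vp vd z) x₀) →
        ∀ᵐ ω ∂μ, Tendsto (fun n => (LLMEngine.chain t π a vp vd z x₀ n ω).size) atTop atTop) := by
  subst hlam hmp hmd
  refine ⟨fun hload Kp Kd _ _ π x₀ S hx₀ hS hπ hwc _ hirr => ?_, fun hload hmax π x₀ hx₀ hπ => ?_⟩
  · subst hS
    exact LLMEngine.isPositiveRecurrentOn_of_isWorkConserving ht ha_meas hvp_meas hvd_meas hz_meas
      hvp_pos hvd_pos ha_indep ha_ident hv_indep hv_ident hav_indep ha_int hvp_int hvd_int hvd_sq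
      hload hx₀ hπ hwc hirr
  · have hproj : Measurable fun p : ℕ × ℕ × F => (p.1, p.2.1) := by fun_prop
    exact LLMEngine.ae_tendsto_size_atTop hb ht hvd_pos ha_indep ha_ident
      (hv_indep.comp (fun _ p => (p.1, p.2.1)) fun _ => hproj) (fun i => (hv_ident i).comp hproj)
      ha_int hvp_int hvd_int hload hmax hx₀ hπ
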